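/- Let $\mathbf{X}$ be an infinite-dimensional complex Banach space, let $A$ be a closed, densely defined linear operator in $\mathbf{X}$ with domain $\mathfrak{D}(A)$, and let $\mathbf{E}$, $\mathbf{F}$ be complex Banach spaces with dense continuous embeddings $\mathbf{E}\overset{\imath}{\hookrightarrow}\mathbf{X}\overset{\jmath}{\hookrightarrow}\mathbf{F}$. Assume that $A$, considered as a mapping $\mathbf{F}\to\mathbf{F}$ (that is, the operator $\jmath A\jmath^{-1}$ with domain $\jmath(\mathfrak{D}(A))$), is closable. The discrete spectrum $\sigma_{\mathrm{d}}(T)$ of a closed operator $T$ is the set of isolated points $\lambda$ of its spectrum $\sigma(T)$ for which $T-\lambda I$ is Fredholm, and $\sigma_{\mathrm{ess}}(T)=\sigma(T)\setminus\sigma_{\mathrm{d}}(T)$. Write $\mathbb{D}_\delta(z_0)=\{z\in\mathbb{C}:|z-z_0|<\delta\}$. Let $\Omega\subset\mathbb{C}\setminus\sigma(A)$ be a connected open set and let $z_0\in\sigma_{\mathrm{ess}}(A)\cap\partial\Omega$. The rank of $z_0$ relative to $(\Omega,\mathbf{E},\mathbf{F})$ is the smallest $r\in\{0,1,2,\dots\}$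 (if there is any) for which there is a bounded operator $B$ in $\mathbf{X}$ of rank $r$ with a bounded finite-rank extension $\hat B$ to $\mathbf{F}$ (so that $\hat B\jmath=\jmath B$) whose range lies in $\jmath\imath(\mathbf{E})$, such that for some $\delta>0$ one has $\Omega\cap\sigma(A+B)\cap\mathbb{D}_\delta(z_0)=\emptyset$ and $\jmath(A+B-zI)^{-1}\imath:\mathbf{E}\to\mathbf{F}$ has a limit in the weak operator topology as $z\to z_0$, $z\in\Omega\cap\mathbb{D}_\delta(z_0)$. The point $z_0$ is a virtual level of rank $r$ relative to $(\Omega,\mathbf{E},\mathbf{F})$ if it has rank $r\ge 1$. (i) Suppose that there are bounded operators $\check V_j:\mathbf{F}\to\mathbf{E}$, $j\in\mathbb{N}$, with $\|\check V_j\|_{\mathbf{F}\to\mathbf{E}}\to 0$, and points $z_j\in\sigma_{\mathrm{d}}(A+V_j)\cap\Omega$ with $z_j\to z_0$, where $V_j=\imath\check V_j\jmath$. Then $\jmath(A-zI)^{-1}\imath$ has no limit in the weak operator topology of mappings $\mathbf{E}\to\mathbf{F}$ as $z\to z_0$, $z\in\Omega$. (ii) Suppose that $z_0$ is a virtual level of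 $A$ of rank $r\ge 1$ relative to $(\Omega,\mathbf{E},\mathbf{F})$, and that for some bounded finite-rank operator $\check B:\mathbf{F}\to\mathbf{E}$ and some $\delta>0$, with $B=\imath\check B\jmath$, one has $\Omega\cap\sigma(A+B)\cap\mathbb{D}_\delta(z_0)=\emptyset$ and $\jmath(A+B-zI)^{-1}\imath$ has a limit in the strong operator topology of mappings $\mathbf{E}\to\mathbf{F}$ as $z\to z_0$, $z\in\Omega\cap\mathbb{D}_\delta(z_0)$. Then there is $\delta_1\in(0,\delta)$ such that for every sequence $z_j\in\Omega\cap\mathbb{D}_{\delta_1}(z_0)$ with $z_j\to z_0$ there are bounded finite-rank operators $\check V_j:\mathbf{F}\to\mathbf{E}$ with $\|\check V_j\|_{\mathbf{F}\to\mathbf{E}}\to 0$ and $z_j\in\sigma_{\mathrm{d}}(A+V_j)$ for every $j\in\mathbb{N}$, where $V_j=\imath\check V_j\jmath$. -/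

import Mathlib

open Filter Topology

noncomputable section

section UnboundedOperators

variable {X : Type*} [NormedAddCommGroup X] [NormedSpace ℂ X]

/-- `A - z I` as a linear map on the domain of `A`. -/
def LinearPMap.subScalar (A : X →ₗ.[ℂ] X) (z : ℂ) : A.domain →ₗ[ℂ] X :=
  A.toFun - z • A.domain.subtype

/-- `A + V`, for a bounded operator `V`; its domain is the domain of `A`. -/
def LinearPMap.addBounded (A : X →ₗ.[ℂ] X) (V : X →L[ℂ] X) : X →ₗ.[ℂ] X :=
  (V : X →ₗ[ℂ] X) +ᵥ A

/-- `R` is a bounded two-sided inverse of `A - z I : 𝔇(A) → X`. -/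
def LinearPMap.IsResolventAt (A : X →ₗ.[ℂ] X) (z : ℂ) (R : X →L[ℂ] X) : Prop :=
  (∀ y : X, ∃ h : R y ∈ A.domain, A.subScalar z ⟨R y, h⟩ = y) ∧
    ∀ x : A.domain, R (A.subScalar z x) = x

theorem LinearPMap.IsResolventAt.unique {A : X →ₗ.[ℂ] X} {z : ℂ} {R S : X →L[ℂ] X}
    (hR : A.IsResolventAt z R) (hS : A.IsResolventAt z S) : R = S := by
  ext y
  obtain ⟨h, hy⟩ := hR.1 y
  have h2 := hS.2 ⟨R y, h⟩
  rw [hy] at h2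
  exact h2.symm

/-- The resolvent set `ℂ \ σ(A)`. -/
def LinearPMap.resolventSet (A : X →ₗ.[ℂ] X) : Set ℂ :=
  {z | ∃ R : X →L[ℂ] X, A.IsResolventAt z R}

/-- The spectrum `σ(A)`. -/
def LinearPMap.spectrum (A : X →ₗ.[ℂ] X) : Set ℂ := (A.resolventSet)ᶜ

open Classical in
/-- The resolvent `(A - z I)⁻¹` for `z` in the resolvent set (and `0` otherwise). -/
def LinearPMap.resolventOp (A : X →ₗ.[ℂ] X) (z : ℂ) : X →L[ℂ] X :=
  if h : ∃ R : X →L[ℂ] X, A.IsResolventAt z R then h.choose else 0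

theorem LinearPMap.isResolventAt_resolventOp {A : X →ₗ.[ℂ] X} {z : ℂ}
    (h : z ∈ A.resolventSet) : A.IsResolventAt z (A.resolventOp z) := by
  have h' : ∃ R : X →L[ℂ] X, A.IsResolventAt z R := h
  rw [LinearPMap.resolventOp, dif_pos h']
  exact h'.choose_spec

/-- `A - z I` is Fredholm: finite-dimensional kernel, closed range of finite codimension. -/
def LinearPMap.IsFredholmAt (A : X →ₗ.[ℂ] X) (z : ℂ) : Prop :=
  FiniteDimensional ℂ (LinearMap.ker (A.subScalar z)) ∧
    _root_.IsClosed (LinearMap.range (A.subScalar z) : Set X) ∧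
    FiniteDimensional ℂ (X ⧸ LinearMap.range (A.subScalar z))

/-- The discrete spectrum: isolated points `z` of the spectrum with `A - z I` Fredholm. -/
def LinearPMap.discreteSpectrum (A : X →ₗ.[ℂ] X) : Set ℂ :=
  {z | z ∈ A.spectrum ∧ (∃ ε > 0, A.spectrum ∩ Metric.ball z ε = {z}) ∧ A.IsFredholmAt z}

/-- The essential spectrum `σ(A) \ σ_d(A)`. -/
def LinearPMap.essentialSpectrum (A : X →ₗ.[ℂ] X) : Set ℂ :=
  A.spectrum \ A.discreteSpectrum

/-- `A` considered as a mapping in a larger space `F`, along an injective `j : X → F`: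
the operator `j ∘ A ∘ j⁻¹` with domain `j (𝔇(A))`. -/
def LinearPMap.transport {F : Type*} [NormedAddCommGroup F] [NormedSpace ℂ F]
    (A : X →ₗ.[ℂ] X) (j : X →L[ℂ] F) (hj : Function.Injective j) : F →ₗ.[ℂ] F where
  domain := A.domain.map (j : X →ₗ[ℂ] F)
  toFun := ((j : X →ₗ[ℂ] F) ∘ₗ A.toFun) ∘ₗ
    ((Submodule.equivMapOfInjective (j : X →ₗ[ℂ] F) hj A.domain).symm :
      A.domain.map (j : X →ₗ[ℂ] F) →ₗ[ℂ] A.domain)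

end UnboundedOperators

section VirtualLevels

variable {E X F : Type*} [NormedAddCommGroup E] [NormedSpace ℂ E]
  [NormedAddCommGroup X] [NormedSpace ℂ X] [NormedAddCommGroup F] [NormedSpace ℂ F]

/-- The operators `j ∘ (A - z I)⁻¹ ∘ i : E → F` converge to `L` in the weak operator topology
as `z → z₀`, `z ∈ Ω`. -/
def HasWeakResolventLimit (A : X →ₗ.[ℂ] X) (i : E →L[ℂ] X) (j : X →L[ℂ] F)
    (Ω : Set ℂ) (z₀ : ℂ) (L : E →L[ℂ] F) : Prop :=
  ∀ (φ : E) (f : StrongDual ℂ F),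
    Tendsto (fun z => f (j (A.resolventOp z (i φ)))) (𝓝[Ω] z₀) (𝓝 (f (L φ)))

/-- The operators `j ∘ (A - z I)⁻¹ ∘ i : E → F` converge to `L` in the strong operator topology
as `z → z₀`, `z ∈ Ω`. -/
def HasStrongResolventLimit (A : X →ₗ.[ℂ] X) (i : E →L[ℂ] X) (j : X →L[ℂ] F)
    (Ω : Set ℂ) (z₀ : ℂ) (L : E →L[ℂ] F) : Prop :=
  ∀ φ : E, Tendsto (fun z => j (A.resolventOp z (i φ))) (𝓝[Ω] z₀) (𝓝 (L φ))

/-- There is `B ∈ 𝓑₀₀(X)` of rank `r`, with a bounded finite rank extension `B'` to `F` whose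
range lies in `j (i (E))`, such that `σ(A + B)` does not meet `Ω` near `z₀` and
`j ∘ (A + B - z I)⁻¹ ∘ i` has a weak limit as `z → z₀` in `Ω`. -/
def IsRegularizedByRank (A : X →ₗ.[ℂ] X) (i : E →L[ℂ] X) (j : X →L[ℂ] F)
    (Ω : Set ℂ) (z₀ : ℂ) (r : ℕ) : Prop :=
  ∃ (B : X →L[ℂ] X) (B' : F →L[ℂ] F),
    FiniteDimensional ℂ (LinearMap.range (B : X →ₗ[ℂ] X)) ∧
    Module.finrank ℂ (LinearMap.range (B : X →ₗ[ℂ] X)) = r ∧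
    FiniteDimensional ℂ (LinearMap.range (B' : F →ₗ[ℂ] F)) ∧
    (∀ x : X, B' (j x) = j (B x)) ∧
    (∀ Ψ : F, ∃ φ : E, B' Ψ = j (i φ)) ∧
    ∃ δ > 0, Ω ∩ (A.addBounded B).spectrum ∩ Metric.ball z₀ δ = ∅ ∧
      ∃ L : E →L[ℂ] F,
        HasWeakResolventLimit (A.addBounded B) i j (Ω ∩ Metric.ball z₀ δ) z₀ L

/-- `z₀` is a point of the essential spectrum of `A` of (finite) rank `r` relative to
`(Ω, E, F)`. -/
def IsEssentialPointOfRank (A : X →ₗ.[ℂ] X) (i : E →L[ℂ] X) (j : X →L[ℂ] F)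
    (Ω : Set ℂ) (z₀ : ℂ) (r : ℕ) : Prop :=
  z₀ ∈ A.essentialSpectrum ∩ frontier Ω ∧ IsLeast {n | IsRegularizedByRank A i j Ω z₀ n} r

/-- `z₀` is a virtual level of `A` of rank `r ≥ 1` relative to `(Ω, E, F)`. -/
def IsVirtualLevel (A : X →ₗ.[ℂ] X) (i : E →L[ℂ] X) (j : X →L[ℂ] F)
    (Ω : Set ℂ) (z₀ : ℂ) (r : ℕ) : Prop :=
  1 ≤ r ∧ IsEssentialPointOfRank A i j Ω z₀ r

end VirtualLevels

end

open Filter Topology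

noncomputable section

/-! ### Resolvents under bounded perturbation. -/

namespace LinearPMap

variable {E X F : Type*} [NormedAddCommGroup E] [NormedSpace ℂ E]
  [NormedAddCommGroup X] [NormedSpace ℂ X] [NormedAddCommGroup F] [NormedSpace ℂ F]

/-! Write R(z) for the resolvent of A. For (i), a weak limit makes j R(z_n) i bounded by uniform
boundedness, so 1 + V_n j R(z_n) i is invertible for some n by a Neumann series, and z_n is then not
in the spectrum of the perturbed operator. For (ii), let L be the strong limit for A + B. If 1 - B L
were injective on the finite-dimensional range of B, then j R(z) i would itself converge
(`HasStrongResolventLimit.exists_of_injective`), giving rank 0. Hence ψ = B L ψ for some ψ ≠ 0. Take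
f with f(Lψ) = 1 and T(z) = j (A + B - z)⁻¹ i ψ. The second resolvent identity gives T(z) = j R(z) i
(ψ - B T(z)), where the argument ψ - B T(z) tends to 0 while T(z) does not. Rescaling it gives a
small e with f(j R(z) i e) = -1, so z is an eigenvalue for the rank one perturbation built from f
and e. A further small change of e makes the eigenvalue isolated. -/

theorem addBounded_zero (A : X →ₗ.[ℂ] X) : A.addBounded 0 = A := by
  have : ((0 : X →L[ℂ] X) : X →ₗ[ℂ] X) = 0 := rfl
  rw [addBounded, this, zero_vadd]

theorem subScalar_apply (A : X →ₗ.[ℂ] X) (z : ℂ) (x : A.domain) :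
    A.subScalar z x = A x - z • (x : X) := rfl

theorem addBounded_subScalar_apply (A : X →ₗ.[ℂ] X) (V : X →L[ℂ] X) (z : ℂ) (x : A.domain) :
    (A.addBounded V).subScalar z x = A.subScalar z x + V x := by
  change (V x + A x) - z • (x : X) = (A x - z • (x : X)) + V x
  abel

theorem isResolventAt_addBounded_iff {A : X →ₗ.[ℂ] X} {V : X →L[ℂ] X} {z : ℂ} {R : X →L[ℂ] X} :
    (A.addBounded V).IsResolventAt z R ↔
      (∀ y : X, ∃ h : R y ∈ A.domain, A.subScalar z ⟨R y, h⟩ + V (R y) = y) ∧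
        ∀ x : A.domain, R (A.subScalar z x + V x) = x := by
  constructor
  · rintro ⟨h₁, h₂⟩
    refine ⟨fun y => ?_, fun x => ?_⟩
    · obtain ⟨h, hy⟩ := h₁ y
      exact ⟨h, (addBounded_subScalar_apply A V z ⟨R y, h⟩).symm.trans hy⟩
    · exact (congrArg R (addBounded_subScalar_apply A V z x)).symm.trans (h₂ x)
  · rintro ⟨h₁, h₂⟩
    refine ⟨fun y => ?_, fun x => ?_⟩
    · obtain ⟨h, hy⟩ := h₁ y
      exact ⟨h, (addBounded_subScalar_apply A V z ⟨R y, h⟩).trans hy⟩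
    · exact (congrArg R (addBounded_subScalar_apply A V z x)).trans (h₂ x)

theorem IsResolventAt.mem_resolventSet {A : X →ₗ.[ℂ] X} {z : ℂ} {R : X →L[ℂ] X}
    (h : A.IsResolventAt z R) : z ∈ A.resolventSet := ⟨R, h⟩

/-- Perturbation by an operator factoring through `E` and `F`. -/
theorem IsResolventAt.addBounded {A : X →ₗ.[ℂ] X} {z : ℂ} {R : X →L[ℂ] X}
    (hR : A.IsResolventAt z R) (i : E →L[ℂ] X) (j : X →L[ℂ] F) (W : F →L[ℂ] E) (S : E →L[ℂ] E)
    (h₁ : ∀ φ, S φ + W (j (R (i (S φ)))) = φ) (h₂ : ∀ φ, S (φ + W (j (R (i φ)))) = φ) :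
    (A.addBounded (i ∘L W ∘L j)).IsResolventAt z (R - R ∘L i ∘L S ∘L W ∘L j ∘L R) := by
  -- Woodbury formula: `S` inverts 1 + W j R i, so only an inverse on `E` is needed.
  rw [isResolventAt_addBounded_iff]
  constructor
  · intro y
    obtain ⟨hd, hy⟩ := hR.1 (y - i (S (W (j (R y)))))
    have he : (R - R ∘L i ∘L S ∘L W ∘L j ∘L R) y = R (y - i (S (W (j (R y))))) := by simp
    rw [he]
    refine ⟨hd, ?_⟩
    rw [hy]
    have h := congrArg i (h₁ (W (j (R y))))
    simp only [_root_.map_add] at h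
    simp only [ContinuousLinearMap.comp_apply, _root_.map_sub]
    rw [← sub_eq_zero] at h ⊢
    rw [← neg_eq_zero, ← h]
    abel
  · intro x
    have hx := hR.2 x
    have h := congrArg (fun φ => R (i φ)) (h₂ (W (j x)))
    simp only [_root_.map_add] at h
    simp only [_root_.sub_apply, ContinuousLinearMap.comp_apply, _root_.map_add, hx]
    rw [← sub_eq_zero] at h ⊢
    rw [← neg_eq_zero, ← h]
    abel

/-- The second resolvent identity. -/
theorem IsResolventAt.sub_eq {A : X →ₗ.[ℂ] X} {z : ℂ} {R R' V : X →L[ℂ] X}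
    (hR : A.IsResolventAt z R) (hR' : (A.addBounded V).IsResolventAt z R') (y : X) :
    R' y = R y - R (V (R' y)) := by
  obtain ⟨hd, hy⟩ := (isResolventAt_addBounded_iff.1 hR').1 y
  have h := hR.2 ⟨R' y, hd⟩
  rw [eq_sub_of_add_eq hy, _root_.map_sub] at h
  exact h.symm

/-- The first resolvent identity. -/
theorem IsResolventAt.sub_eq_smul {A : X →ₗ.[ℂ] X} {z w : ℂ} {R S : X →L[ℂ] X}
    (hR : A.IsResolventAt z R) (hS : A.IsResolventAt w S) (y : X) :
    S y - R y = (w - z) • S (R y) := by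
  obtain ⟨hd, hy⟩ := hR.1 y
  have h := hS.2 ⟨R y, hd⟩
  have h' : A.subScalar w ⟨R y, hd⟩ = y - (w - z) • R y := by
    rw [eq_sub_iff_add_eq]
    refine Eq.trans ?_ hy
    rw [subScalar_apply, subScalar_apply, sub_smul]
    abel
  rw [h', _root_.map_sub, _root_.map_smul] at h
  change _ = R y at h
  exact sub_eq_of_eq_add (eq_add_of_sub_eq' h)

/-- By the first resolvent identity R(w)(1 - (w - z)R(z)) = R(z), and inversion is differentiable at
1. Analyticity is what isolates zeros of the secular function. -/
theorem differentiableOn_resolventOp [CompleteSpace X] {A : X →ₗ.[ℂ] X} {Ω : Set ℂ}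
    (hΩ : Ω ⊆ A.resolventSet) (hΩo : IsOpen Ω) : DifferentiableOn ℂ A.resolventOp Ω := by
  intro z hz
  refine DifferentiableAt.differentiableWithinAt ?_
  set R := A.resolventOp z
  have hR : A.IsResolventAt z R := isResolventAt_resolventOp (hΩ hz)
  have haff : Differentiable ℂ (fun w : ℂ => (1 : X →L[ℂ] X) - (w - z) • R) := by fun_prop
  have hone : (1 : X →L[ℂ] X) - (z - z) • R = 1 := by simp
  have hunit : ∀ᶠ w in 𝓝 z, IsUnit ((1 : X →L[ℂ] X) - (w - z) • R) := by
    refine haff.continuous.continuousAt.eventually ?_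
    exact Units.isOpen.mem_nhds (by simp)
  have heq : A.resolventOp =ᶠ[𝓝 z]
      fun w => R * Ring.inverse ((1 : X →L[ℂ] X) - (w - z) • R) := by
    filter_upwards [hunit, hΩo.mem_nhds hz] with w hw hwΩ
    have hS := isResolventAt_resolventOp (hΩ hwΩ)
    have h : A.resolventOp w * (1 - (w - z) • R) = R := by
      ext y
      have := hR.sub_eq_smul hS y
      simp only [mul_sub, mul_one, _root_.sub_apply, mul_apply_eq_comp,
        _root_.smul_apply, _root_.map_smul]
      rw [← this]
      abel
    conv_rhs => enter [1]; rw [← h]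
    rw [mul_assoc, Ring.mul_inverse_cancel _ hw, mul_one]
  refine DifferentiableAt.congr_of_eventuallyEq ?_ heq
  refine DifferentiableAt.mul (differentiableAt_const R) ?_
  have hinv : DifferentiableAt ℂ (Ring.inverse : (X →L[ℂ] X) → (X →L[ℂ] X))
      ((1 : X →L[ℂ] X) - (z - z) • R) := by
    rw [hone]
    exact differentiableAt_inverse (𝕜 := ℂ) (isUnit_one (M := X →L[ℂ] X))
  exact hinv.comp z haff.differentiableAt

/-! ### Eigenvalues of rank one perturbations. -/

section RankOne

variable {A : X →ₗ.[ℂ] X} {i : E →L[ℂ] X} {j : X →L[ℂ] F} {f : StrongDual ℂ F} {e : E}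

theorem mem_resolventSet_addBounded_smulRight {z : ℂ} {R : X →L[ℂ] X}
    (hR : A.IsResolventAt z R) (h : 1 + f (j (R (i e))) ≠ 0) :
    z ∈ (A.addBounded (i ∘L f.smulRight e ∘L j)).resolventSet := by
  set d := f (j (R (i e))) with hd
  refine (hR.addBounded i j (f.smulRight e)
    (1 - (1 + d)⁻¹ • (f.smulRight e ∘L j ∘L R ∘L i)) ?_ ?_).mem_resolventSet
  · intro φ
    simp only [_root_.sub_apply, one_apply_eq_self,
      _root_.smul_apply, ContinuousLinearMap.comp_apply,
      ContinuousLinearMap.smulRight_apply, _root_.map_sub, _root_.map_smul, ← hd]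
    match_scalars <;> field_simp
    ring
  · intro φ
    simp only [_root_.sub_apply, one_apply_eq_self,
      _root_.smul_apply, ContinuousLinearMap.comp_apply,
      ContinuousLinearMap.smulRight_apply, _root_.map_add, _root_.map_smul, ← hd]
    match_scalars <;> field_simp
    ring

/-- The secular equation of a rank one perturbation. -/
theorem mem_discreteSpectrum_of_secular [CompleteSpace X] {Ω : Set ℂ}
    (hΩo : IsOpen Ω) (hΩc : IsConnected Ω) (hΩ : Ω ⊆ A.resolventSet) {z w : ℂ}
    (hz : z ∈ Ω) (hw : w ∈ Ω) (hez : f (j (A.resolventOp z (i e))) = -1)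
    (hew : f (j (A.resolventOp w (i e))) ≠ -1) :
    z ∈ (A.addBounded (i ∘L f.smulRight e ∘L j)).discreteSpectrum := by
  set V := i ∘L f.smulRight e ∘L j with hV
  have hVx : ∀ x, V x = f (j x) • i e := fun x => by simp [hV]
  set R := A.resolventOp z
  have hR : A.IsResolventAt z R := isResolventAt_resolventOp (hΩ hz)
  have hsub : ∀ x : A.domain, (A.addBounded V).subScalar z x
      = A.subScalar z x + f (j x) • i e := fun x => by
    rw [← hVx]; exact addBounded_subScalar_apply A V z x
  obtain ⟨hu, huz⟩ := hR.1 (i e)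
  have hzσ : z ∈ (A.addBounded V).spectrum := by
    rintro ⟨S, hS⟩
    have h := hS.2 ⟨R (i e), hu⟩
    have h0 : (A.addBounded V).subScalar z ⟨R (i e), hu⟩ = 0 := by
      refine (hsub ⟨R (i e), hu⟩).trans ?_
      rw [huz, hez]; simp
    rw [h0, _root_.map_zero] at h
    change 0 = R (i e) at h
    rw [← h] at hez
    simp at hez
  refine ⟨hzσ, ?_, ?_, ?_⟩
  -- The value at `w` keeps this analytic function from vanishing identically on the connected set
  -- `Ω`, so its zero at `z` is isolated.
  · have hD : DifferentiableOn ℂ (fun w => 1 + f (j (A.resolventOp w (i e)))) Ω := by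
      have h1 := differentiableOn_resolventOp hΩ hΩo
      have h2 : DifferentiableOn ℂ (fun w => A.resolventOp w (i e)) Ω :=
        h1.clm_apply (differentiableOn_const _)
      exact (((f ∘L j).differentiable.comp_differentiableOn h2)).const_add 1
    rcases (hD.analyticOnNhd hΩo z hz).eventually_eq_zero_or_eventually_ne_zero with h | h
    · have h0 := (hD.analyticOnNhd hΩo).eqOn_zero_of_preconnected_of_eventuallyEq_zero
        hΩc.isPreconnected hz h hw
      exact absurd (eq_neg_of_add_eq_zero_right h0) hew
    · rw [eventually_nhdsWithin_iff] at h
      obtain ⟨ε, hε, hball⟩ := Metric.eventually_nhds_iff_ball.1 (h.and (hΩo.mem_nhds hz))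
      refine ⟨ε, hε, Set.Subset.antisymm ?_ ?_⟩
      · rintro x ⟨hxσ, hx⟩
        by_contra hxz
        exact hxσ (mem_resolventSet_addBounded_smulRight
          (isResolventAt_resolventOp (hΩ (hball x hx).2)) ((hball x hx).1 hxz))
      · rintro x rfl
        exact ⟨hzσ, Metric.mem_ball_self hε⟩
  · set K := LinearMap.ker ((A.addBounded V).subScalar z)
    have hle : ∀ x : K, ((x : (A.addBounded V).domain) : X) ∈ Submodule.span ℂ {R (i e)} := by
      rintro ⟨x, hx⟩
      change A.domain at x
      have hx' : A.subScalar z x + f (j x) • i e = 0 := (hsub x).symm.trans hx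
      have h := hR.2 x
      rw [eq_neg_of_add_eq_zero_left hx', _root_.map_neg, _root_.map_smul, ← neg_smul] at h
      exact Submodule.mem_span_singleton.2 ⟨_, h⟩
    exact Module.Finite.of_injective
      (((A.addBounded V).domain.subtype ∘ₗ K.subtype).codRestrict _ hle)
      fun x y hxy => by
        have h := congrArg (Submodule.subtype _) hxy
        exact Subtype.ext (Subtype.ext h)
  -- Since f(j R i e) = -1, applying f j R to an element of the range cancels its two terms;
  -- conversely R y is a preimage of any y killed by f j R.
  · have hrange : LinearMap.range ((A.addBounded V).subScalar z)
        = LinearMap.ker ((f ∘L j ∘L R : X →L[ℂ] ℂ) : X →ₗ[ℂ] ℂ) := by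
      ext y
      constructor
      · rintro ⟨x, rfl⟩
        change A.domain at x
        refine (congrArg (fun y => f (j (R y))) (hsub x)).trans ?_
        simp [hR.2 x, hez]
      · intro hy
        obtain ⟨hd, hdy⟩ := hR.1 y
        have hy' : f (j (R y)) = 0 := hy
        refine ⟨⟨R y, hd⟩, (hsub ⟨R y, hd⟩).trans ?_⟩
        rw [hdy, hy']
        simp
    rw [hrange]
    exact ⟨(f ∘L j ∘L R : X →L[ℂ] ℂ).isClosed_ker, (LinearMap.quotKerEquivRange
      ((f ∘L j ∘L R : X →L[ℂ] ℂ) : X →ₗ[ℂ] ℂ)).symm.finiteDimensional⟩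

/-- If the secular function also vanishes at a second point w, adding to e a small vector that
changes the value at w but not at z removes that zero. -/
theorem exists_norm_sub_le_mem_discreteSpectrum [CompleteSpace X]
    (hA : Dense (A.domain : Set X)) (hi : DenseRange i) {Ω : Set ℂ}
    (hΩo : IsOpen Ω) (hΩc : IsConnected Ω) (hΩ : Ω ⊆ A.resolventSet) {z : ℂ}
    (hz : z ∈ Ω) (hez : f (j (A.resolventOp z (i e))) = -1) {η : ℝ} (hη : 0 < η) :
    ∃ e' : E, ‖e' - e‖ ≤ η ∧
      z ∈ (A.addBounded (i ∘L f.smulRight e' ∘L j)).discreteSpectrum := by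
  obtain ⟨w, hwz, hw⟩ : ∃ w, w ≠ z ∧ w ∈ Ω := by
    have h := (hΩo.mem_nhds hz)
    have : ∀ᶠ w in 𝓝[≠] z, w ≠ z ∧ w ∈ Ω :=
      (eventually_mem_nhdsWithin).and (nhdsWithin_le_nhds h)
    exact this.exists
  by_cases hew : f (j (A.resolventOp w (i e))) = -1
  · obtain ⟨a, haz, haw⟩ : ∃ a : E, f (j (A.resolventOp z (i a))) = 0 ∧
        f (j (A.resolventOp w (i a))) ≠ 0 := by
      by_contra! hcon
      have hR := isResolventAt_resolventOp (hΩ hz)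
      have hS := isResolventAt_resolventOp (hΩ hw)
      set R := A.resolventOp z
      set S := A.resolventOp w
      -- The kernel of f j R i lies in that of f j S i, and both functionals equal -1 at `e`, so
      -- they coincide.
      have h1 : ∀ a : E, f (j (S (i a))) = f (j (R (i a))) := by
        intro a
        have := hcon (a + f (j (R (i a))) • e) (by simp [hez])
        simp only [_root_.map_add, _root_.map_smul, hew, smul_eq_mul, mul_neg_one] at this
        exact add_neg_eq_zero.1 this
      -- Equality on all of `X` forces f j S R = 0 by the first resolvent identity, hence f j S
      -- vanishes on the dense domain.
      have h2 : ∀ y, f (j (S y)) = f (j (R y)) := congrFun <|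
        hi.equalizer (f ∘L j ∘L S).continuous (f ∘L j ∘L R).continuous (funext h1)
      have h3 : ∀ x ∈ A.domain, f (j (S x)) = 0 := by
        intro x hx
        have h4 := congrArg (fun y => f (j y)) (hR.sub_eq_smul hS (A.subScalar z ⟨x, hx⟩))
        simp only [_root_.map_sub, h2, _root_.map_smul, sub_self, smul_eq_mul] at h4
        rw [hR.2, ← h2] at h4
        exact (mul_eq_zero.1 h4.symm).resolve_left (sub_ne_zero.2 hwz)
      have h5 := Continuous.ext_on hA (f ∘L j ∘L S).continuous continuous_const
        (g := fun _ => (0 : ℂ)) h3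
      have h6 : f (j (S (i e))) = 0 := congrFun h5 (i e)
      rw [h6] at hew
      norm_num at hew
    obtain ⟨c, hc, hca⟩ : ∃ c : ℝ, 0 < c ∧ c * ‖a‖ ≤ η := by
      refine ⟨η / (‖a‖ + 1), by positivity, ?_⟩
      rw [div_mul_eq_mul_div, div_le_iff₀ (by positivity)]
      nlinarith
    refine ⟨e + (c : ℂ) • a, ?_, ?_⟩
    · simpa [norm_smul, abs_of_pos hc] using hca
    · refine mem_discreteSpectrum_of_secular hΩo hΩc hΩ hz hw ?_ ?_
      · simp [hez, haz]
      · simp [hew, haw, hc.ne']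
  · exact ⟨e, by simpa using hη.le, mem_discreteSpectrum_of_secular hΩo hΩc hΩ hz hw hez hew⟩

end RankOne

/-- Small perturbations do not create spectrum where the sandwiched resolvent is bounded. -/
theorem mem_resolventSet_addBounded_of_norm_lt [CompleteSpace E] {A : X →ₗ.[ℂ] X} {z : ℂ}
    {R : X →L[ℂ] X} (hR : A.IsResolventAt z R) (i : E →L[ℂ] X) (j : X →L[ℂ] F) (W : F →L[ℂ] E)
    (h : ‖W‖ * ‖j ∘L R ∘L i‖ < 1) : z ∈ (A.addBounded (i ∘L W ∘L j)).resolventSet := by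
  have hlt : ‖-(W ∘L j ∘L R ∘L i)‖ < 1 := by
    rw [norm_neg]
    exact (ContinuousLinearMap.opNorm_comp_le _ _).trans_lt h
  set u := Units.oneSub _ hlt
  have hu : ∀ φ, (u : E →L[ℂ] E) φ = φ + W (j (R (i φ))) := fun φ => by simp [u]
  refine (hR.addBounded i j W (↑u⁻¹ : E →L[ℂ] E) ?_ ?_).mem_resolventSet
  · intro φ
    rw [← hu]
    exact congrArg (fun T : E →L[ℂ] E => T φ) u.mul_inv
  · intro φ
    rw [← hu]
    exact congrArg (fun T : E →L[ℂ] E => T φ) u.inv_mul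

end LinearPMap

/-! ### Convergence of operators in finite dimension. -/

theorem tendsto_clm_of_forall_apply {ι G H : Type*} [NormedAddCommGroup G] [NormedSpace ℂ G]
    [NormedAddCommGroup H] [NormedSpace ℂ H] [FiniteDimensional ℂ G] {l : Filter ι}
    {T : ι → G →L[ℂ] H} {L : G →L[ℂ] H} (h : ∀ x, Tendsto (fun a => T a x) l (𝓝 (L x))) :
    Tendsto T l (𝓝 L) := by
  let b := Module.finBasis ℂ G
  have key : ∀ S : G →L[ℂ] H,
      S = ∑ k, (LinearMap.toContinuousLinearMap (b.coord k)).smulRight (S (b k)) := by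
    intro S
    ext x
    conv_lhs => rw [← b.sum_repr x]
    simp only [map_sum, map_smul]
    simp
  rw [key L]
  refine Tendsto.congr (fun a => (key (T a)).symm) ?_
  refine tendsto_finsetSum _ fun k _ => ?_
  exact ((ContinuousLinearMap.smulRightL ℂ G H
    (LinearMap.toContinuousLinearMap (b.coord k))).continuous.tendsto _).comp (h (b k))

theorem tendsto_clm_apply {ι G H : Type*} [NormedAddCommGroup G] [NormedSpace ℂ G]
    [NormedAddCommGroup H] [NormedSpace ℂ H] {l : Filter ι} {T : ι → G →L[ℂ] H} {L : G →L[ℂ] H}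
    {x : ι → G} {y : G} (hT : Tendsto T l (𝓝 L)) (hx : Tendsto x l (𝓝 y)) :
    Tendsto (fun a => T a (x a)) l (𝓝 (L y)) :=
  ((isBoundedBilinearMap_apply (𝕜 := ℂ)).continuous.tendsto (L, y)).comp (hT.prodMk_nhds hx)

/-- In finite dimension pointwise convergence is norm convergence and an injective limit is a unit;
units are open and inversion is continuous there. -/
theorem tendsto_inverse_of_injective {ι G : Type*} [NormedAddCommGroup G] [NormedSpace ℂ G]
    [FiniteDimensional ℂ G] {l : Filter ι} {M : ι → G →L[ℂ] G} {M₀ : G →L[ℂ] G}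
    (h : ∀ x, Tendsto (fun a => M a x) l (𝓝 (M₀ x))) (hinj : ∀ x, M₀ x = 0 → x = 0) :
    (∀ᶠ a in l, IsUnit (M a)) ∧
      Tendsto (fun a => Ring.inverse (M a)) l (𝓝 (Ring.inverse M₀)) := by
  have hG : CompleteSpace G := FiniteDimensional.complete ℂ G
  have hM := tendsto_clm_of_forall_apply h
  have hunit : IsUnit M₀ := by
    rw [ContinuousLinearMap.isUnit_iff_bijective]
    have hi : Function.Injective (M₀ : G →ₗ[ℂ] G) :=
      LinearMap.ker_eq_bot.1 (LinearMap.ker_eq_bot'.2 hinj)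
    exact ⟨hi, LinearMap.injective_iff_surjective.1 hi⟩
  refine ⟨hM.eventually (Units.isOpen.mem_nhds hunit), ?_⟩
  obtain ⟨u, rfl⟩ := hunit
  exact (NormedRing.inverse_continuousAt u).tendsto.comp hM

/-! ### Limits of sandwiched resolvents. -/

section VirtualLevels

variable {E X F : Type*} [NormedAddCommGroup E] [NormedSpace ℂ E]
  [NormedAddCommGroup X] [NormedSpace ℂ X] [NormedAddCommGroup F] [NormedSpace ℂ F]

open LinearPMap (isResolventAt_resolventOp addBounded_zero)

/-- A weakly convergent family of sandwiched resolvents is bounded along sequences. -/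
theorem HasWeakResolventLimit.exists_norm_le [CompleteSpace E] {A : X →ₗ.[ℂ] X}
    {i : E →L[ℂ] X} {j : X →L[ℂ] F} {Ω : Set ℂ} {z₀ : ℂ} {L : E →L[ℂ] F}
    (h : HasWeakResolventLimit A i j Ω z₀ L) {z : ℕ → ℂ} (hz : Tendsto z atTop (𝓝 z₀))
    (hzΩ : ∀ n, z n ∈ Ω) : ∃ C, ∀ n, ‖j ∘L A.resolventOp (z n) ∘L i‖ ≤ C := by
  have hz' : Tendsto z atTop (𝓝[Ω] z₀) :=
    tendsto_nhdsWithin_iff.2 ⟨hz, Eventually.of_forall hzΩ⟩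
  refine banach_steinhaus fun φ => ?_
  -- Uniform boundedness is used twice: on the dual of `F` for each fixed φ, then on `E`.
  have hb : ∃ C, ∀ n, ‖NormedSpace.inclusionInDoubleDual ℂ F
      (j (A.resolventOp (z n) (i φ)))‖ ≤ C := by
    refine banach_steinhaus fun f => ?_
    obtain ⟨C, hC⟩ := ((h φ f).comp hz').norm.bddAbove_range
    exact ⟨C, fun n => hC ⟨n, rfl⟩⟩
  obtain ⟨C, hC⟩ := hb
  refine ⟨C, fun n => ?_⟩
  have := (NormedSpace.inclusionInDoubleDualLi (𝕜 := ℂ) (E := F)).norm_map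
    (j (A.resolventOp (z n) (i φ)))
  exact this.symm.le.trans (hC n)

theorem isRegularizedByRank_zero {A : X →ₗ.[ℂ] X} {i : E →L[ℂ] X} {j : X →L[ℂ] F}
    {Ω : Set ℂ} (hΩ : Ω ⊆ A.resolventSet) {z₀ : ℂ} {δ : ℝ} (hδ : 0 < δ) {L : E →L[ℂ] F}
    (h : HasWeakResolventLimit A i j (Ω ∩ Metric.ball z₀ δ) z₀ L) :
    IsRegularizedByRank A i j Ω z₀ 0 := by
  have h0 : LinearMap.range ((0 : X →L[ℂ] X) : X →ₗ[ℂ] X) = ⊥ := LinearMap.range_zero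
  have h0' : LinearMap.range ((0 : F →L[ℂ] F) : F →ₗ[ℂ] F) = ⊥ := LinearMap.range_zero
  refine ⟨0, 0, ?_, ?_, ?_, by simp, fun _ => ⟨0, by simp⟩, δ, hδ, ?_, L, ?_⟩
  · rw [h0]; infer_instance
  · rw [h0]; simp
  · rw [h0']; infer_instance
  · rw [addBounded_zero]
    ext x
    simp only [Set.mem_inter_iff, Set.mem_empty_iff_false, iff_false]
    exact fun hx => hx.1.2 (hΩ hx.1.1)
  · rwa [addBounded_zero]

/-- If `j (A + B - z)⁻¹ i` has a strong limit `L` and `1 - B L` is injective on the range of `B`,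
then `j (A - z)⁻¹ i` has a strong limit. -/
theorem HasStrongResolventLimit.exists_of_injective {A : X →ₗ.[ℂ] X}
    {i : E →L[ℂ] X} {j : X →L[ℂ] F} {Ω : Set ℂ} {z₀ : ℂ} {L : E →L[ℂ] F} {B : F →L[ℂ] E}
    [FiniteDimensional ℂ (LinearMap.range (B : F →ₗ[ℂ] E))]
    (h : HasStrongResolventLimit (A.addBounded (i ∘L B ∘L j)) i j Ω z₀ L)
    (hA : Ω ⊆ A.resolventSet) (hB : Ω ⊆ (A.addBounded (i ∘L B ∘L j)).resolventSet)
    (hinj : ∀ ψ ∈ LinearMap.range (B : F →ₗ[ℂ] E), B (L ψ) = ψ → ψ = 0) :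
    ∃ L' : E →L[ℂ] F, HasStrongResolventLimit A i j Ω z₀ L' := by
  set G := LinearMap.range (B : F →ₗ[ℂ] E)
  set B₁ : F →L[ℂ] G := B.codRestrict G (fun x => ⟨x, rfl⟩)
  set T : ℂ → E →L[ℂ] F := fun z => j ∘L (A.addBounded (i ∘L B ∘L j)).resolventOp z ∘L i
  have hTL : ∀ φ, Tendsto (fun z => T z φ) (𝓝[Ω] z₀) (𝓝 (L φ)) := h
  have hTG : Tendsto (fun z => T z ∘L G.subtypeL) (𝓝[Ω] z₀) (𝓝 (L ∘L G.subtypeL)) :=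
    tendsto_clm_of_forall_apply fun x => hTL x
  -- Restricting 1 - B S to the range of `B` reduces its inversion to finite dimension.
  set M : (E →L[ℂ] F) → G →L[ℂ] G := fun S => 1 - B₁ ∘L S ∘L G.subtypeL
  obtain ⟨hev, hinv⟩ : (∀ᶠ z in 𝓝[Ω] z₀, IsUnit (M (T z))) ∧
      Tendsto (fun z => Ring.inverse (M (T z))) (𝓝[Ω] z₀) (𝓝 (Ring.inverse (M L))) := by
    refine tendsto_inverse_of_injective (fun x => tendsto_const_nhds.sub
      ((B₁.continuous.tendsto _).comp (hTL x))) fun ψ hψ => ?_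
    have h1 : (ψ : G) - B₁ (L ψ) = 0 := hψ
    have h2 : B (L ψ) = ψ := (congrArg Subtype.val (sub_eq_zero.1 h1)).symm
    exact Subtype.ext (hinj ψ ψ.2 h2)
  refine ⟨L + L ∘L G.subtypeL ∘L Ring.inverse (M L) ∘L B₁ ∘L L, fun φ => ?_⟩
  have hlim : Tendsto (fun z => T z φ +
      (T z ∘L G.subtypeL) (Ring.inverse (M (T z)) (B₁ (T z φ)))) (𝓝[Ω] z₀)
      (𝓝 (L φ + (L ∘L G.subtypeL) (Ring.inverse (M L) (B₁ (L φ))))) :=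
    (hTL φ).add (tendsto_clm_apply hTG (tendsto_clm_apply hinv
      ((B₁.continuous.tendsto _).comp (hTL φ))))
  refine hlim.congr' ?_
  filter_upwards [hev, self_mem_nhdsWithin] with z hz hzΩ
  have hid : ∀ x : E, T z x = j (A.resolventOp z (i x)) - j (A.resolventOp z (i (B (T z x)))) := by
    intro x
    have := congrArg j ((isResolventAt_resolventOp (hA hzΩ)).sub_eq
      (isResolventAt_resolventOp (hB hzΩ)) (i x))
    rw [map_sub] at this
    exact this
  -- With T₀ = j R(z) i, the identity T₀(1 - B T) = T and (1 - B T)g = B T φ give T₀φ = Tφ + T₀ B T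
  -- φ = Tφ + T g.
  set g := Ring.inverse (M (T z)) (B₁ (T z φ))
  have hMg : M (T z) g = B₁ (T z φ) :=
    congrArg (fun S : G →L[ℂ] G => S (B₁ (T z φ))) (Ring.mul_inverse_cancel _ hz)
  have hMg' : (g : E) - B (T z g) = B (T z φ) := congrArg Subtype.val hMg
  change T z φ + T z g = _
  rw [hid φ, hid g, ← hMg']
  simp only [map_sub]
  abel

end VirtualLevels

end

theorem mainTheorem3 {E X F : Type*}
    [NormedAddCommGroup E] [NormedSpace ℂ E] [CompleteSpace E]
    [NormedAddCommGroup X] [NormedSpace ℂ X] [CompleteSpace X]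
    [NormedAddCommGroup F] [NormedSpace ℂ F] [CompleteSpace F]
    (hX : ¬ FiniteDimensional ℂ X)
    (i : E →L[ℂ] X) (hi : Function.Injective i) (hi_dense : DenseRange i)
    (j : X →L[ℂ] F) (hj : Function.Injective j) (hj_dense : DenseRange j)
    (A : X →ₗ.[ℂ] X) (hA_closed : A.IsClosed) (hA_dense : Dense (A.domain : Set X))
    (hA_closable : (A.transport j hj).IsClosable)
    (Ω : Set ℂ) (hΩ_open : IsOpen Ω) (hΩ_conn : IsConnected Ω) (hΩ : Ω ⊆ A.resolventSet)
    (z₀ : ℂ) (hz₀ : z₀ ∈ A.essentialSpectrum ∩ frontier Ω) :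
    -- (i) bifurcations from `z₀` exclude a weak limit
    (∀ (V : ℕ → F →L[ℂ] E) (z : ℕ → ℂ),
      Tendsto (fun n => ‖V n‖) atTop (𝓝 0) →
      (∀ n, z n ∈ (A.addBounded (i ∘L V n ∘L j)).discreteSpectrum ∩ Ω) →
      Tendsto z atTop (𝓝 z₀) →
      ¬ ∃ L : E →L[ℂ] F, HasWeakResolventLimit A i j Ω z₀ L) ∧
    -- (ii) bifurcations along any prescribed sequence
    (∀ (r : ℕ), IsVirtualLevel A i j Ω z₀ r →
      ∀ (B : F →L[ℂ] E) (δ : ℝ), 0 < δ →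
        FiniteDimensional ℂ (LinearMap.range (B : F →ₗ[ℂ] E)) →
        Ω ∩ (A.addBounded (i ∘L B ∘L j)).spectrum ∩ Metric.ball z₀ δ = ∅ →
        (∃ L : E →L[ℂ] F, HasStrongResolventLimit (A.addBounded (i ∘L B ∘L j)) i j
          (Ω ∩ Metric.ball z₀ δ) z₀ L) →
        ∃ δ₁ : ℝ, 0 < δ₁ ∧ δ₁ < δ ∧
          ∀ z : ℕ → ℂ, (∀ n, z n ∈ Ω ∩ Metric.ball z₀ δ₁) → Tendsto z atTop (𝓝 z₀) →
            ∃ V : ℕ → F →L[ℂ] E,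
              (∀ n, FiniteDimensional ℂ (LinearMap.range (V n : F →ₗ[ℂ] E))) ∧
              Tendsto (fun n => ‖V n‖) atTop (𝓝 0) ∧
              ∀ n, z n ∈ (A.addBounded (i ∘L V n ∘L j)).discreteSpectrum) := by
  constructor
  · rintro V z hV hz hzt ⟨L, hL⟩
    obtain ⟨C, hC⟩ := hL.exists_norm_le hzt fun n => (hz n).2
    have h0 : Tendsto (fun n => ‖V n‖ * C) atTop (𝓝 0) := by simpa using hV.mul_const C
    obtain ⟨n, hn⟩ := (h0.eventually_lt_const one_pos).exists
    refine (hz n).1.1 (LinearPMap.mem_resolventSet_addBounded_of_norm_lt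
      (LinearPMap.isResolventAt_resolventOp (hΩ (hz n).2)) i j (V n) ?_)
    exact (mul_le_mul_of_nonneg_left (hC n) (norm_nonneg _)).trans_lt hn
  · rintro r ⟨hr, -, hleast⟩ B δ hδ hBfin hBσ ⟨L, hL⟩
    have hΩA : Ω ∩ Metric.ball z₀ δ ⊆ A.resolventSet := Set.inter_subset_left.trans hΩ
    have hΩB : Ω ∩ Metric.ball z₀ δ ⊆ (A.addBounded (i ∘L B ∘L j)).resolventSet := by
      intro z hz
      by_contra hcon
      exact (Set.eq_empty_iff_forall_notMem.1 hBσ z) ⟨⟨hz.1, hcon⟩, hz.2⟩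
    obtain ⟨ψ, hψ, hψ0⟩ : ∃ ψ : E, B (L ψ) = ψ ∧ ψ ≠ 0 := by
      by_contra! hcon
      obtain ⟨L', hL'⟩ := hL.exists_of_injective hΩA hΩB fun ψ _ h => hcon ψ h
      have := hleast.2 (isRegularizedByRank_zero hΩ hδ
        fun φ f => (f.continuous.tendsto _).comp (hL' φ))
      omega
    have hLψ : L ψ ≠ 0 := by
      intro h
      rw [h, map_zero] at hψ
      exact hψ0 hψ.symm
    obtain ⟨f, hf⟩ := SeparatingDual.exists_eq_one (R := ℂ) hLψ
    set T : ℂ → F := fun z => j ((A.addBounded (i ∘L B ∘L j)).resolventOp z (i ψ))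
    have hTlim : Tendsto T (𝓝[Ω ∩ Metric.ball z₀ δ] z₀) (𝓝 (L ψ)) := hL ψ
    have hfT : Tendsto (fun z => f (T z)) (𝓝[Ω ∩ Metric.ball z₀ δ] z₀) (𝓝 1) := by
      rw [← hf]; exact (f.continuous.tendsto _).comp hTlim
    -- The radius keeps f(T(z)) nonzero, so that every term of the sequence can be normalized; δ/2
    -- makes it strictly less than δ.
    obtain ⟨ε, hε, hεT⟩ := Metric.eventually_nhds_iff_ball.1
      (eventually_nhdsWithin_iff.1 (hfT.eventually_ne one_ne_zero))
    have hδ₁ : min ε (δ / 2) < δ := (min_le_right _ _).trans_lt (half_lt_self hδ)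
    refine ⟨min ε (δ / 2), lt_min hε (half_pos hδ), hδ₁, fun z hz hzt => ?_⟩
    have hzδ : ∀ n, z n ∈ Ω ∩ Metric.ball z₀ δ := fun n =>
      ⟨(hz n).1, Metric.ball_subset_ball hδ₁.le (hz n).2⟩
    have hc : ∀ n, f (T (z n)) ≠ 0 := fun n =>
      hεT (z n) (Metric.ball_subset_ball (min_le_left _ _) (hz n).2) (hzδ n)
    have hzt' : Tendsto z atTop (𝓝[Ω ∩ Metric.ball z₀ δ] z₀) :=
      tendsto_nhdsWithin_iff.2 ⟨hzt, Eventually.of_forall hzδ⟩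
    -- The scalar is forced by f(j R i e) = -1, because T = j R i (ψ - B T).
    set e : ℕ → E := fun n => (-(f (T (z n)))⁻¹) • (ψ - B (T (z n))) with he
    have he0 : Tendsto e atTop (𝓝 0) := by
      have h1 : Tendsto (fun n => ψ - B (T (z n))) atTop (𝓝 (ψ - B (L ψ))) :=
        tendsto_const_nhds.sub ((B.continuous.tendsto _).comp (hTlim.comp hzt'))
      have h2 := ((hfT.comp hzt').inv₀ one_ne_zero).neg.smul h1
      rw [hψ, sub_self, smul_zero] at h2
      exact h2
    have hez : ∀ n, f (j (A.resolventOp (z n) (i (e n)))) = -1 := by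
      intro n
      have hid := congrArg j
        ((LinearPMap.isResolventAt_resolventOp (hΩA (hzδ n))).sub_eq
          (LinearPMap.isResolventAt_resolventOp (hΩB (hzδ n))) (i ψ))
      have hid' : T (z n) = j (A.resolventOp (z n) (i (ψ - B (T (z n))))) := by
        rw [map_sub i, map_sub (A.resolventOp (z n))]
        exact hid
      simp only [he, map_smul]
      rw [← hid', smul_eq_mul, neg_mul, inv_mul_cancel₀ (hc n)]
    -- Corrections of size at most 1/(n + 1) preserve convergence to 0.
    choose e' he' hσ using fun n : ℕ =>
      LinearPMap.exists_norm_sub_le_mem_discreteSpectrum hA_dense hi_dense hΩ_open hΩ_conn hΩ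
        (hz n).1 (hez n) (Nat.one_div_pos_of_nat (α := ℝ) (n := n))
    refine ⟨fun n => f.smulRight (e' n), fun n => ?_, ?_, hσ⟩
    · refine Submodule.finiteDimensional_of_le (S₂ := Submodule.span ℂ {e' n}) ?_
      rintro _ ⟨x, rfl⟩
      exact Submodule.mem_span_singleton.2 ⟨f x, rfl⟩
    · have hd : Tendsto (fun n => e' n - e n) atTop (𝓝 0) :=
        squeeze_zero_norm he' tendsto_one_div_add_atTop_nhds_zero_nat
      have he'0 : Tendsto (fun n => ‖e' n‖) atTop (𝓝 0) := by
        simpa using (hd.add he0).norm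
      simpa [ContinuousLinearMap.norm_smulRight_apply] using he'0.const_mul ‖f‖
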